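/- Let $\mathcal S$ be the category of complex super vector spaces, i.e. of left modules over $\mathbb{C}\mathbb{Z}_2$ ($\mathbb{Z}_2=\{1,g\}$), with even maps; for $V=V_0\oplus V_1$ the generator $g$ acts by $(-1)^d$ on $V_d$. It is symmetric monoidal with the diagonal action on $V\otimes W$ and the braiding $\psi$ given by the $R$-matrix $R=\frac12(1\otimes1+1\otimes g+g\otimes1-g\otimes g)$, i.e. $\psi(v\otimes w)=(-1)^{|v||w|}w\otimes v$ on homogeneous vectors. Let $H=H_0\oplus H_1$ be a super Hopf algebra, i.e. a Hopf algebra $(H,m,\eta,\Delta,\varepsilon,S)$ in $\mathcal S$. Let $(\delta,\sigma)$ be a braided modular pair in involution: $\delta:H\to\mathbb{C}$ is an even algebra map, $\sigma:\mathbb{C}\to H$ is an even coalgebra map (we also write $\sigma$ for $\sigma(1)\in H$), $\delta\sigma=\mathrm{id}$, and $m(m\otimes \mathrm{id})(S\sigma\otimes\widetilde S^2\otimes\sigma)=\mathrm{id}_H$, where $\widetilde S=(\delta\otimes S)\Delta$. The braided Connes–Moscovici complex of $(H,\delta,\sigma)$ is defined, by formulas that make sense in any braided monoidal category with unit object $I$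 (here $I=\mathbb{C}$), by $C^0(H)=I$, $C^n(H)=H^{n}:=H^{\otimes n}$ for $n\ge1$, with * faces $\delta_i:C^{n-1}(H)\to C^n(H)$, $n\ge1$, $0\le i\le n$: $\delta_0=(\eta,1,\dots,1)$, $\delta_i=(1,\dots,1,\Delta,1,\dots,1)$ with $\Delta$ at the $i$-th place for $1\le i\le n-1$, and $\delta_n=(1,\dots,1,\sigma)$; * degeneracies $\sigma_i:C^{n+1}(H)\to C^n(H)$, $0\le i\le n$: $\sigma_i=(1,\dots,1,\varepsilon,1,\dots,1)$ with $\varepsilon$ at the $(i+1)$-st place; * cyclic maps $\tau_0=\mathrm{id}$ and $\tau_n=m_n(\Delta^{n-1}\widetilde S,1_{H^{n-1}},\sigma)$ for $n\ge 1$, where $m_n=(m,\dots,m)\,\mathcal F_n(\psi):H^n\otimes H^n\to H^n$ with $n$ copies of $m$, and $\mathcal F_n(\psi)=\prod_{j=1}^{n-1}(1_{H^j},\underbrace{\psi,\dots,\psi}_{n-j},1_{H^j})$ is a composition of maps, the factor $j=n-1$ being applied first. Then, writing $(h_1,\dots,h_n)=h_1\otimes\cdots\otimes h_n$, these are given explicitly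 as follows. One has $C^0(H)=\mathbb{C}$, and $C^n(H)$ is the $n$-th tensor power of the vector space $H$. For all elements of $H$, $$\delta_i(h_1,\dots,h_{n-1})=\begin{cases}(1,h_1,\dots,h_{n-1}) & i=0\\ (h_1,\dots,h_i^{(1)},h_i^{(2)},\dots,h_{n-1}) & 1\le i\le n-1\\ (h_1,\dots,h_{n-1},\sigma) & i=n,\end{cases}$$ $$\sigma_i(h_1,\dots,h_{n+1})=\varepsilon(h_{i+1})\,(h_1,\dots,h_i,h_{i+2},\dots,h_{n+1}),\qquad 0\le i\le n,$$ and $\tau_0=\mathrm{id}$. Moreover, every $\Delta^{n-1}(a)$, $a\in H$, $n\ge 1$, is a finite sum $\sum a^{(1)}\otimes\cdots\otimes a^{(n)}$ with homogeneous entries, and for $n\ge1$, homogeneous $h_1,\dots,h_n$ and every such expansion $\Delta^{n-1}(h_1)=\sum h_1^{(1)}\otimes\cdots\otimes h_1^{(n)}$, $$\tau_n(h_1,\dots,h_n)=\sum\alpha\beta\,\bigl(S(h_1^{(n)})h_2,\,S(h_1^{(n-1)})h_3,\dots,S(h_1^{(2)})h_n,\,\widetilde S(h_1^{(1)})\sigma\bigr),$$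 $$\alpha=\prod_{i=1}^{n-1}(-1)^{(|h_1^{(1)}|+\cdots+|h_1^{(i)}|)\,|h_1^{(i+1)}|},\qquad \beta=\prod_{j=1}^{n-1}(-1)^{|h_1^{(j)}|\,(|h_2|+|h_3|+\cdots+|h_{n-j+1}|)}.$$ -/

import Mathlib

open CategoryTheory MonoidalCategory
open scoped TensorProduct MonObj ComonObj

/-! ### The braided monoidal category of super vector spaces -/

/-- A complex super vector space, given as a module over the group algebra of the cyclic group of
order two: a complex vector space with an involution `parity` (the action of the generator). -/
structure SuperSpace where
  carrier : Type
  [addCommGroup : AddCommGroup carrier]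
  [module : Module ℂ carrier]
  parity : carrier →ₗ[ℂ] carrier
  parity_parity : ∀ v, parity (parity v) = v

namespace SuperSpace

instance : CoeSort SuperSpace Type := ⟨carrier⟩

attribute [instance] addCommGroup module

/-- The homogeneous part of degree `d`: the vectors on which `parity` acts as `(-1) ^ d`. -/
def homogeneous (V : SuperSpace) (d : ZMod 2) : Submodule ℂ V :=
  Module.End.eigenspace V.parity ((-1) ^ d.val)

/-- An even linear map. -/
@[ext]
structure Hom (V W : SuperSpace) where
  toLin : V →ₗ[ℂ] W
  parity_toLin : ∀ v, W.parity (toLin v) = toLin (V.parity v)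

instance : Category SuperSpace where
  Hom := Hom
  id V := ⟨LinearMap.id, fun _ => rfl⟩
  comp f g := ⟨g.toLin ∘ₗ f.toLin, fun v => by
    simp [f.parity_toLin, g.parity_toLin]⟩

instance (V W : SuperSpace) : CoeFun (V ⟶ W) (fun _ => V → W) := ⟨fun f => f.toLin⟩

@[ext]
theorem hom_ext {V W : SuperSpace} {f g : V ⟶ W} (h : f.toLin = g.toLin) : f = g :=
  Hom.ext h

@[simp] theorem id_toLin (V : SuperSpace) : Hom.toLin (𝟙 V) = LinearMap.id := rfl

@[simp] theorem comp_toLin {U V W : SuperSpace} (f : U ⟶ V) (g : V ⟶ W) :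
    (f ≫ g).toLin = g.toLin ∘ₗ f.toLin := rfl

/-- An isomorphism from a linear equivalence that commutes with the parities. -/
def isoMk {V W : SuperSpace} (e : V ≃ₗ[ℂ] W) (h : ∀ v, W.parity (e v) = e (V.parity v)) :
    V ≅ W where
  hom := ⟨e.toLinearMap, h⟩
  inv := ⟨e.symm.toLinearMap, fun w => by
    apply e.injective
    simp [← h]⟩
  hom_inv_id := by ext; simp
  inv_hom_id := by ext; simp

/-- The tensor product: the generator acts diagonally. -/
abbrev tensor (V W : SuperSpace) : SuperSpace where
  carrier := V ⊗[ℂ] W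
  parity := TensorProduct.map V.parity W.parity
  parity_parity v := by
    induction v using TensorProduct.induction_on with
    | zero => simp
    | tmul x y => simp [parity_parity]
    | add x y hx hy => rw [map_add, map_add, hx, hy]

/-- The unit object: `ℂ` with the trivial action. -/
abbrev unitSpace : SuperSpace where
  carrier := ℂ
  parity := LinearMap.id
  parity_parity _ := rfl

/-- The tensor product of even maps. -/
def tensorMap {V W V' W' : SuperSpace} (f : V ⟶ W) (g : V' ⟶ W') :
    tensor V V' ⟶ tensor W W' where
  toLin := TensorProduct.map f.toLin g.toLin
  parity_toLin v := by
    change TensorProduct.map W.parity W'.parity (TensorProduct.map f.toLin g.toLin v) =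
      TensorProduct.map f.toLin g.toLin (TensorProduct.map V.parity V'.parity v)
    induction v using TensorProduct.induction_on with
    | zero => simp
    | tmul x y => simp [f.parity_toLin, g.parity_toLin]
    | add x y hx hy => simp only [map_add, hx, hy]

instance : MonoidalCategoryStruct SuperSpace where
  tensorObj := tensor
  tensorUnit := unitSpace
  tensorHom := tensorMap
  whiskerLeft X _ _ f := tensorMap (𝟙 X) f
  whiskerRight f Y := tensorMap f (𝟙 Y)
  associator U V W := isoMk (TensorProduct.assoc ℂ U V W) <| LinearMap.congr_fun
    (f := TensorProduct.map U.parity (TensorProduct.map V.parity W.parity) ∘ₗ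
      (TensorProduct.assoc ℂ U V W).toLinearMap)
    (g := (TensorProduct.assoc ℂ U V W).toLinearMap ∘ₗ
      TensorProduct.map (TensorProduct.map U.parity V.parity) W.parity)
    (TensorProduct.ext_threefold fun _ _ _ => rfl)
  leftUnitor V := isoMk (TensorProduct.lid ℂ V) <| LinearMap.congr_fun
    (f := V.parity ∘ₗ (TensorProduct.lid ℂ V).toLinearMap)
    (g := (TensorProduct.lid ℂ V).toLinearMap ∘ₗ TensorProduct.map LinearMap.id V.parity)
    (TensorProduct.ext' fun a y => V.parity.map_smul a y)
  rightUnitor V := isoMk (TensorProduct.rid ℂ V) <| LinearMap.congr_fun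
    (f := V.parity ∘ₗ (TensorProduct.rid ℂ V).toLinearMap)
    (g := (TensorProduct.rid ℂ V).toLinearMap ∘ₗ TensorProduct.map V.parity LinearMap.id)
    (TensorProduct.ext' fun x a => V.parity.map_smul a x)

instance : MonoidalCategory SuperSpace := MonoidalCategory.ofTensorHom
  (id_tensorHom_id := fun _ _ => hom_ext TensorProduct.map_id)
  (id_tensorHom := fun _ _ _ _ => rfl)
  (tensorHom_id := fun _ _ => rfl)
  (tensorHom_comp_tensorHom := fun _ _ _ _ => hom_ext (TensorProduct.map_comp _ _ _ _).symm)
  (associator_naturality := fun _ _ _ => hom_ext (TensorProduct.ext_threefold fun _ _ _ => rfl))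
  (leftUnitor_naturality := fun f => hom_ext (TensorProduct.ext' fun a y =>
    (f.toLin.map_smul a y).symm))
  (rightUnitor_naturality := fun f => hom_ext (TensorProduct.ext' fun x a =>
    (f.toLin.map_smul a x).symm))
  (pentagon := fun _ _ _ _ => hom_ext (TensorProduct.ext_fourfold fun _ _ _ _ => rfl))
  (triangle := fun X Y => hom_ext (TensorProduct.ext_threefold fun x a y =>
    (TensorProduct.smul_tmul (R := ℂ) (R' := ℂ) (M := X) (N := Y) a x y).symm))

/-- The braiding `v ⊗ w ↦ (R₂ w) ⊗ (R₁ v)` for the universal `R`-matrix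
`R = (1 ⊗ 1 + 1 ⊗ g + g ⊗ 1 - g ⊗ g) / 2`, where `g` acts by `parity`. -/
noncomputable def braidLin (V W : SuperSpace) : V ⊗[ℂ] W →ₗ[ℂ] W ⊗[ℂ] V :=
  (2⁻¹ : ℂ) •
    (TensorProduct.map LinearMap.id LinearMap.id + TensorProduct.map W.parity LinearMap.id +
      TensorProduct.map LinearMap.id V.parity - TensorProduct.map W.parity V.parity) ∘ₗ
    (TensorProduct.comm ℂ V W).toLinearMap

theorem braidLin_tmul (V W : SuperSpace) (v : V) (w : W) :
    braidLin V W (v ⊗ₜ w) = (2⁻¹ : ℂ) • (w ⊗ₜ[ℂ] v + W.parity w ⊗ₜ[ℂ] v +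
      w ⊗ₜ[ℂ] V.parity v - W.parity w ⊗ₜ[ℂ] V.parity v) := by
  simp [braidLin]

/-- On homogeneous vectors the braiding is the flip with the Koszul sign. -/
theorem braidLin_homogeneous (V W : SuperSpace) {a b : ZMod 2} {v : V} {w : W}
    (hv : v ∈ V.homogeneous a) (hw : w ∈ W.homogeneous b) :
    braidLin V W (v ⊗ₜ w) = (-1 : ℂ) ^ (a * b).val • w ⊗ₜ[ℂ] v := by
  rw [homogeneous, Module.End.mem_eigenspace_iff] at hv hw
  rw [braidLin_tmul, hv, hw]
  simp only [TensorProduct.smul_tmul', TensorProduct.tmul_smul]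
  have h2 : ∀ c : ZMod 2, c = 0 ∨ c = 1 := by decide
  rcases h2 a with rfl | rfl <;> rcases h2 b with rfl | rfl <;>
    simp [ZMod.val_one] <;> module

theorem braidLin_braidLin (V W : SuperSpace) (x : V ⊗[ℂ] W) :
    braidLin W V (braidLin V W x) = x := by
  induction x using TensorProduct.induction_on with
  | zero => simp
  | tmul v w =>
    simp only [braidLin_tmul, map_smul, map_add, map_sub, parity_parity]
    module
  | add x y hx hy => simp only [map_add, hx, hy]

/-- The braiding as an isomorphism of super vector spaces. -/
noncomputable def braid (V W : SuperSpace) : tensor V W ≅ tensor W V :=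
  isoMk (LinearEquiv.ofLinearMap (braidLin V W) (braidLin W V)
    (LinearMap.ext (braidLin_braidLin W V)) (LinearMap.ext (braidLin_braidLin V W))) fun x => by
      change TensorProduct.map W.parity V.parity (braidLin V W x) =
        braidLin V W (TensorProduct.map V.parity W.parity x)
      induction x using TensorProduct.induction_on with
      | zero => simp
      | tmul v w =>
        simp only [braidLin_tmul, map_smul, map_add, map_sub, parity_parity,
          TensorProduct.map_tmul]
      | add x y hx hy => simp only [map_add, hx, hy]

noncomputable instance : SymmetricCategory SuperSpace where
  braiding := braid
  braiding_naturality_right X Y Z f := hom_ext <| TensorProduct.ext' fun x y => by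
    change braidLin X Z (x ⊗ₜ f y) = TensorProduct.map f.toLin LinearMap.id (braidLin X Y (x ⊗ₜ y))
    simp only [braidLin_tmul, map_smul, map_add, map_sub, TensorProduct.map_tmul,
      LinearMap.id_apply, f.parity_toLin]
  braiding_naturality_left {X Y} f Z := hom_ext <| TensorProduct.ext' fun x z => by
    change braidLin Y Z (f x ⊗ₜ z) = TensorProduct.map LinearMap.id f.toLin (braidLin X Z (x ⊗ₜ z))
    simp only [braidLin_tmul, map_smul, map_add, map_sub, TensorProduct.map_tmul,
      LinearMap.id_apply, f.parity_toLin]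
  hexagon_forward X Y Z := hom_ext <| TensorProduct.ext_threefold fun x y z => by
    refine (congrArg (TensorProduct.assoc ℂ Y Z X)
      (braidLin_tmul X (tensor Y Z) x (y ⊗ₜ z))).trans ?_
    change TensorProduct.assoc ℂ Y Z X ((2⁻¹ : ℂ) • ((y ⊗ₜ[ℂ] z) ⊗ₜ[ℂ] x +
        (Y.parity y ⊗ₜ[ℂ] Z.parity z) ⊗ₜ[ℂ] x + (y ⊗ₜ[ℂ] z) ⊗ₜ[ℂ] X.parity x -
        (Y.parity y ⊗ₜ[ℂ] Z.parity z) ⊗ₜ[ℂ] X.parity x)) =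
      TensorProduct.map LinearMap.id (braidLin X Z) (TensorProduct.assoc ℂ Y X Z
        (braidLin X Y (x ⊗ₜ y) ⊗ₜ z))
    simp only [braidLin_tmul, map_smul, map_add, map_sub, TensorProduct.map_tmul,
      LinearMap.id_apply, TensorProduct.assoc_tmul, ← TensorProduct.smul_tmul',
      TensorProduct.add_tmul, TensorProduct.sub_tmul, TensorProduct.tmul_smul,
      TensorProduct.tmul_add, TensorProduct.tmul_sub, parity_parity]
    module
  hexagon_reverse X Y Z := hom_ext <| TensorProduct.ext' fun x w => by
    induction w using TensorProduct.induction_on with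
    | zero => rw [TensorProduct.tmul_zero, map_zero, map_zero]
    | tmul y z =>
      refine (congrArg (TensorProduct.assoc ℂ Z X Y).symm
        (braidLin_tmul (tensor X Y) Z (x ⊗ₜ y) z)).trans ?_
      change (TensorProduct.assoc ℂ Z X Y).symm ((2⁻¹ : ℂ) • (z ⊗ₜ[ℂ] (x ⊗ₜ[ℂ] y) +
          Z.parity z ⊗ₜ[ℂ] (x ⊗ₜ[ℂ] y) + z ⊗ₜ[ℂ] (X.parity x ⊗ₜ[ℂ] Y.parity y) -
          Z.parity z ⊗ₜ[ℂ] (X.parity x ⊗ₜ[ℂ] Y.parity y))) =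
        TensorProduct.map (braidLin X Z) LinearMap.id ((TensorProduct.assoc ℂ X Z Y).symm
          (x ⊗ₜ braidLin Y Z (y ⊗ₜ z)))
      simp only [braidLin_tmul, map_smul, map_add, map_sub, TensorProduct.map_tmul,
        LinearMap.id_apply, TensorProduct.assoc_symm_tmul, ← TensorProduct.smul_tmul',
        TensorProduct.add_tmul, TensorProduct.sub_tmul, TensorProduct.tmul_smul,
        TensorProduct.tmul_add, TensorProduct.tmul_sub, parity_parity]
      module
    | add y z hy hz => rw [TensorProduct.tmul_add, map_add, map_add, hy, hz]
  symmetry X Y := hom_ext <| LinearMap.ext (braidLin_braidLin X Y)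

end SuperSpace

/-! ### The braided Connes-Moscovici complex

Here `H` is a Hopf algebra in a braided monoidal category with braiding `ψ = β_`. -/

namespace ConnesMoscovici

universe v u

section

variable {C : Type u} [Category.{v} C] [MonoidalCategory C] (H : C)

/-- The object `Cⁿ(H) = Hⁿ`, with `H⁰ = I` and `Hⁿ⁺¹ = H ⊗ Hⁿ`. -/
def obj : ℕ → C
  | 0 => 𝟙_ C
  | n + 1 => H ⊗ obj n

/-- `(1, …, 1, σ)`. -/
def snocCochar (σ : 𝟙_ C ⟶ H) : (n : ℕ) → (obj H n ⟶ obj H (n + 1))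
  | 0 => σ ≫ (ρ_ H).inv
  | n + 1 => H ◁ snocCochar σ n

/-- Juxtaposition of tensor powers, `Hᵐ ⊗ Hⁿ ⟶ Hⁿ⁺ᵐ`. -/
def concat : (m n : ℕ) → (obj H m ⊗ obj H n ⟶ obj H (n + m))
  | 0, n => (λ_ (obj H n)).hom
  | m + 1, n => (α_ H (obj H m) (obj H n)).hom ≫ H ◁ concat m n

variable [BraidedCategory C]

/-- `(1_{Hʲ}, ψ, …, ψ, 1)` on `Hᴺ`, with `k` copies of `ψ = ψ_{H,H}` and identities on the
remaining factors; used only for `j + 2 * k ≤ N`. -/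
def braidLayer : (j k N : ℕ) → (obj H N ⟶ obj H N)
  | 0, k + 1, N + 2 => (α_ H H (obj H N)).inv ≫
      ((β_ H H).hom ⊗ₘ braidLayer 0 k N) ≫ (α_ H H (obj H N)).hom
  | j + 1, k, N + 1 => H ◁ braidLayer j k N
  | _, _, _ => 𝟙 _

/-- `F_n(ψ) = ∏_{j=1}^{n-1} (1_{Hʲ}, ψ, …, ψ, 1_{Hʲ})`, with `n - j` copies of `ψ` in the `j`-th
term, on `H²ⁿ`. The product is composition of maps, the term `j = n - 1` being applied first. -/
def shuffle (n : ℕ) : End (obj H (n + n)) :=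
  ((List.range (n - 1)).map fun i =>
    (show End (obj H (n + n)) from braidLayer H (i + 1) (n - (i + 1)) (n + n))).prod

variable [HopfObj H]

/-- The `δ`-twisted antipode `(δ ⊗ S) Δ`. -/
def twistedAntipode (δ : H ⟶ 𝟙_ C) : H ⟶ H :=
  Δ[H] ≫ (δ ⊗ₘ HopfObj.antipode (X := H)) ≫ (λ_ H).hom

/-- `(δ, σ)` is a braided modular pair in involution: `δ` is an algebra map, `σ` is a coalgebra
map, `δ σ = id`, and `m (m ⊗ id) (S σ ⊗ S̃² ⊗ σ) = id`. -/
structure IsBraidedMPI (δ : H ⟶ 𝟙_ C) (σ : 𝟙_ C ⟶ H) : Prop where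
  mul_char : μ[H] ≫ δ = (δ ⊗ₘ δ) ≫ (λ_ (𝟙_ C)).hom
  one_char : η[H] ≫ δ = 𝟙 (𝟙_ C)
  cochar_comul : σ ≫ Δ[H] = (λ_ (𝟙_ C)).inv ≫ (σ ⊗ₘ σ)
  cochar_counit : σ ≫ ε[H] = 𝟙 (𝟙_ C)
  cochar_char : σ ≫ δ = 𝟙 (𝟙_ C)
  involution :
    (ρ_ H).inv ≫ (λ_ H).inv ▷ 𝟙_ C ≫
      (((σ ≫ HopfObj.antipode (X := H)) ⊗ₘ
        (twistedAntipode H δ ≫ twistedAntipode H δ)) ⊗ₘ σ) ≫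
      μ[H] ▷ H ≫ μ[H] = 𝟙 H

/-- `(1, …, 1, Δ, 1, …, 1)` with `Δ` at the (zero-based) position `i`. -/
def comulAt : (n : ℕ) → Fin n → (obj H n ⟶ obj H (n + 1))
  | n + 1, ⟨0, _⟩ => Δ[H] ▷ obj H n ≫ (α_ H H (obj H n)).hom
  | n + 1, ⟨i + 1, h⟩ => H ◁ comulAt n ⟨i, Nat.lt_of_succ_lt_succ h⟩

/-- The faces `δ_i : Cⁿ(H) ⟶ Cⁿ⁺¹(H)`, `0 ≤ i ≤ n + 1`: `(η, 1, …, 1)` for `i = 0`,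
`(1, …, 1, σ)` for `i = n + 1`, and `Δ` at the `i`-th factor otherwise. -/
def face (σ : 𝟙_ C ⟶ H) (n : ℕ) (i : Fin (n + 2)) : obj H n ⟶ obj H (n + 1) :=
  Fin.cases ((λ_ (obj H n)).inv ≫ η[H] ▷ obj H n)
    (fun j => Fin.lastCases (snocCochar H σ n) (comulAt H n) j) i

/-- The degeneracies `σ_i : Cⁿ⁺¹(H) ⟶ Cⁿ(H)`, `0 ≤ i ≤ n`: `ε` at the `(i + 1)`-st factor. -/
def degeneracy : (n : ℕ) → Fin (n + 1) → (obj H (n + 1) ⟶ obj H n)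
  | n, ⟨0, _⟩ => ε[H] ▷ obj H n ≫ (λ_ (obj H n)).hom
  | n + 1, ⟨i + 1, h⟩ => H ◁ degeneracy n ⟨i, Nat.lt_of_succ_lt_succ h⟩

/-- The iterated comultiplication `Δⁿ : H ⟶ Hⁿ⁺¹`. -/
def iterComul : (n : ℕ) → (H ⟶ obj H (n + 1))
  | 0 => (ρ_ H).inv
  | n + 1 => Δ[H] ≫ H ◁ iterComul n

/-- `(m, …, m)` with `n` copies of `m`, on `Hᴺ` with `N = 2n`. -/
def mulPairs : (n N : ℕ) → N = n + n → (obj H N ⟶ obj H n)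
  | 0, 0, _ => 𝟙 _
  | n + 1, N + 2, h => (α_ H H (obj H N)).inv ≫ (μ[H] ⊗ₘ mulPairs n N (by omega))
  | 0, _ + 1, h => absurd h (by omega)
  | _ + 1, 0, h => absurd h (by omega)
  | _ + 1, 1, h => absurd h (by omega)

/-- `m_n = m_{Hⁿ} = (m, …, m) F_n(ψ) : Hⁿ ⊗ Hⁿ ⟶ Hⁿ`. -/
def mulPow (n : ℕ) : obj H n ⊗ obj H n ⟶ obj H n :=
  concat H n n ≫ shuffle H n ≫ mulPairs H n (n + n) rfl

/-- The cyclic maps: `τ_0 = id` and `τ_n = m_n (Δⁿ⁻¹ S̃, 1_{Hⁿ⁻¹}, σ)` for `n ≥ 1`. -/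
def cyclic (δ : H ⟶ 𝟙_ C) (σ : 𝟙_ C ⟶ H) : (n : ℕ) → (obj H n ⟶ obj H n)
  | 0 => 𝟙 _
  | n + 1 => ((twistedAntipode H δ ≫ iterComul H n) ⊗ₘ snocCochar H σ n) ≫ mulPow H (n + 1)

end

/-! ### Elements of the complex of a super Hopf algebra -/

section

variable (H : SuperSpace)

/-- The element `(h_1, …, h_n) = h_1 ⊗ ⋯ ⊗ h_n` of `Cⁿ(H)`. -/
def tensorElt : (n : ℕ) → (Fin n → H) → (obj (C := SuperSpace) H n).carrier
  | 0, _ => (1 : ℂ)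
  | n + 1, h => h 0 ⊗ₜ[ℂ] tensorElt n (Fin.tail h)

variable [HopfObj H]

/-- The product of two elements. -/
def mulElt (a b : H) : H := μ[H] (a ⊗ₜ[ℂ] b : H ⊗[ℂ] H)

/-- The comultiplication on elements. -/
def comulElt (a : H) : H ⊗[ℂ] H := Δ[H] a

/-- The counit on elements. -/
def counitElt (a : H) : ℂ := ε[H] a

/-- The element `1` of `H`. -/
def oneElt : H := η[H] (1 : ℂ)

end

/-- The element of `H` given by a map `σ : ℂ ⟶ H`. -/
def elt {H : SuperSpace} (σ : 𝟙_ SuperSpace ⟶ H) : H := σ (1 : ℂ)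

/-- The sign `α = ∏_{i=1}^{n-1} (-1)^{(|x_1| + ⋯ + |x_i|) |x_{i+1}|}`, for `n + 1` in place of
`n` and zero-based indices, where `e i` is the degree of the `i`-th entry. -/
def signAlpha {n : ℕ} (e : Fin (n + 1) → ZMod 2) : ℂ :=
  ∏ i : Fin n, (-1) ^ ((∑ j ∈ Finset.Iic i.castSucc, e j) * e i.succ).val

/-- The sign `β = ∏_{j=1}^{n-1} (-1)^{|x_j| (|h_2| + ⋯ + |h_{n-j+1}|)}`, for `n + 1` in place of
`n` and zero-based indices, where `e` and `d` are the degrees of the `x_j` and of the `h_l`. -/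
def signBeta {n : ℕ} (e d : Fin (n + 1) → ZMod 2) : ℂ :=
  ∏ j : Fin n, (-1) ^ (e j.castSucc * ∑ l ∈ Finset.Ioc 0 j.castSucc.rev, d l).val

end ConnesMoscovici

/-! The antipode of a braided Hopf algebra is anti-comultiplicative, and so is its `δ`-twist:
`Δ S̃ = (S ⊗ S̃) ψ Δ`. Inductively, `Δⁿ S̃` is `Δⁿ` followed by the reversal of the factors by means
of the braiding, with `S̃` applied to the first factor and `S` to the others. On homogeneous tensors
the last factor moves past all the preceding ones, then the last but one, and so on: this is the
Koszul sign `α`. In `m_n`, the shuffle moves the `j`-th factor on the left past the first `j - 1`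
factors on the right; as the factors on the left have been reversed, the resulting sign is `β`. -/

namespace SuperSpace

variable {V W V' W' : SuperSpace}

theorem neg_one_pow_val_add (a b : ZMod 2) :
    (-1 : ℂ) ^ (a + b).val = (-1) ^ a.val * (-1) ^ b.val := by
  rw [← pow_add, neg_one_pow_eq_pow_mod_two, neg_one_pow_eq_pow_mod_two (n := a.val + b.val),
    ZMod.val_add, Nat.mod_mod]

theorem mem_homogeneous_iff {d : ZMod 2} {v : V} :
    v ∈ V.homogeneous d ↔ V.parity v = (-1 : ℂ) ^ d.val • v :=
  Module.End.mem_eigenspace_iff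

theorem apply_mem_homogeneous (f : V ⟶ W) {d : ZMod 2} {v : V} (hv : v ∈ V.homogeneous d) :
    f v ∈ W.homogeneous d := by
  rw [mem_homogeneous_iff] at hv ⊢
  rw [f.parity_toLin, hv, map_smul]

theorem one_mem_homogeneous : (1 : ℂ) ∈ (𝟙_ SuperSpace).homogeneous 0 :=
  mem_homogeneous_iff.2 (one_smul ℂ (1 : ℂ)).symm

theorem span_homogeneous (V : SuperSpace) :
    Submodule.span ℂ {v : V | ∃ d, v ∈ V.homogeneous d} = ⊤ := by
  refine Submodule.eq_top_iff'.2 fun v => ?_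
  have h_even : v + V.parity v ∈ V.homogeneous 0 := by
    simp [mem_homogeneous_iff, parity_parity, add_comm]
  have h_odd : v - V.parity v ∈ V.homogeneous 1 := by
    simp [mem_homogeneous_iff, parity_parity, ZMod.val_one]
  have h_sum : v = (2⁻¹ : ℂ) • (v + V.parity v) + (2⁻¹ : ℂ) • (v - V.parity v) := by module
  rw [h_sum]
  exact add_mem (Submodule.smul_mem _ _ (Submodule.subset_span ⟨0, h_even⟩))
    (Submodule.smul_mem _ _ (Submodule.subset_span ⟨1, h_odd⟩))

/-- The pure tensor `v ⊗ w`, as an element of the monoidal product of super vector spaces rather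
than of the underlying tensor product of vector spaces. -/
def tmul (V W : SuperSpace) : V →ₗ[ℂ] W →ₗ[ℂ] (V ⊗ W : SuperSpace) :=
  TensorProduct.mk ℂ V W

theorem tensorHom_tmul (f : V ⟶ W) (g : V' ⟶ W') (v : V) (v' : V') :
    (f ⊗ₘ g) (tmul V V' v v') = tmul W W' (f v) (g v') := rfl

theorem braiding_tmul {a b : ZMod 2} {v : V} {w : W} (hv : v ∈ V.homogeneous a)
    (hw : w ∈ W.homogeneous b) :
    (β_ V W).hom (tmul V W v w) = (-1 : ℂ) ^ (a * b).val • tmul W V w v :=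
  braidLin_homogeneous V W hv hw

theorem tmul_mem_homogeneous {a b : ZMod 2} {v : V} {w : W} (hv : v ∈ V.homogeneous a)
    (hw : w ∈ W.homogeneous b) : tmul V W v w ∈ (V ⊗ W : SuperSpace).homogeneous (a + b) := by
  rw [mem_homogeneous_iff] at hv hw ⊢
  have h_parity : (V ⊗ W : SuperSpace).parity (tmul V W v w) =
      tmul V W (V.parity v) (W.parity w) := rfl
  rw [h_parity, hv, hw, LinearMap.map_smul₂, map_smul, smul_smul, neg_one_pow_val_add]

end SuperSpace

namespace ConnesMoscovici

section

universe v u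

variable {C : Type u} [Category.{v} C] [MonoidalCategory C] (H : C)

/-- Splitting off the last tensor factor, `Hⁿ⁺¹ ⟶ Hⁿ ⊗ H`. -/
def splitLast : (n : ℕ) → (obj H (n + 1) ⟶ obj H n ⊗ H)
  | 0 => (ρ_ H).hom ≫ (λ_ H).inv
  | n + 1 => H ◁ splitLast n ≫ (α_ H (obj H n) H).inv

variable [BraidedCategory C]

/-- The composition of braid layers defining `shuffle H n`, acting on the first factors of `Hᴺ`;
letting `N` vary makes it amenable to induction. -/
def shuffleOn (n N : ℕ) : End (obj H N) :=
  ((List.range (n - 1)).map fun i =>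
    (show End (obj H N) from braidLayer H (i + 1) (n - (i + 1)) N)).prod

theorem shuffleOn_succ_succ (n N : ℕ) :
    shuffleOn H (n + 1) (N + 1) = H ◁ (shuffleOn H n N ≫ braidLayer H 0 n N) := by
  have h_layers : ((List.range n).map fun i =>
      (show End (obj H N) from braidLayer H i (n - i) N)).prod =
        shuffleOn H n N ≫ braidLayer H 0 n N := by
    cases n with
    | zero => cases N <;> exact (Category.comp_id _).symm
    | succ n =>
      rw [List.range_succ_eq_map, List.map_cons, List.prod_cons, List.map_map]
      rfl
  rw [← h_layers]
  refine Eq.trans ?_ (map_list_prod (Functor.mapEnd (obj H N) (tensorLeft H)) _).symm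
  rw [List.map_map, shuffleOn, Nat.add_sub_cancel]
  congr 1
  refine List.map_congr_left fun i _ => ?_
  rw [Nat.add_sub_add_right]
  rfl

variable [HopfObj H]

theorem iterComul_splitLast (n : ℕ) :
    iterComul H (n + 1) ≫ splitLast H (n + 1) = Δ[H] ≫ iterComul H n ▷ H := by
  induction n with
  | zero => simp [iterComul, splitLast, obj]
  | succ n ih =>
    change (Δ[H] ≫ H ◁ iterComul H (n + 1)) ≫ H ◁ splitLast H (n + 1) ≫
      (α_ H (obj H (n + 1)) H).inv = Δ[H] ≫ (Δ[H] ≫ H ◁ iterComul H n) ▷ H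
    rw [Category.assoc, ← whiskerLeft_comp_assoc, ih]
    simp [ComonObj.comul_assoc_assoc]

theorem twistedAntipode_comul (δ : H ⟶ 𝟙_ C) :
    twistedAntipode H δ ≫ Δ[H] =
      Δ[H] ≫ (β_ H H).hom ≫ (HopfObj.antipode (X := H) ⊗ₘ twistedAntipode H δ) := by
  have h_eq : twistedAntipode H δ =
      Δ[H] ≫ δ ▷ H ≫ (λ_ H).hom ≫ HopfObj.antipode (X := H) := by
    simp only [twistedAntipode, MonoidalCategory.tensorHom_def, Category.assoc,
      leftUnitor_naturality]
  have h_braid : (β_ H H).hom ≫ (HopfObj.antipode (X := H) ⊗ₘ twistedAntipode H δ) =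
      (Δ[H] ≫ δ ▷ H ≫ (λ_ H).hom) ▷ H ≫ (β_ H H).hom ≫
        (HopfObj.antipode (X := H) ⊗ₘ HopfObj.antipode (X := H)) := by
    rw [BraidedCategory.braiding_naturality_left_assoc, h_eq, MonoidalCategory.tensorHom_def',
      MonoidalCategory.tensorHom_def']
    simp only [whiskerLeft_comp, Category.assoc]
  rw [h_braid, h_eq]
  simp only [Category.assoc, HopfObj.antipode_comul, comp_whiskerRight]
  rw [← leftUnitor_naturality_assoc, ← whisker_exchange_assoc, ComonObj.comul_assoc_flip_assoc]
  simp

variable {H}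

/-- The reversal of the factors of `Hⁿ⁺¹` by means of the braiding, with the twisted antipode
applied to the first factor and the antipode to the others. -/
def twistedReverse (δ : H ⟶ 𝟙_ C) : (n : ℕ) → (obj H (n + 1) ⟶ obj H (n + 1))
  | 0 => twistedAntipode H δ ▷ 𝟙_ C
  | n + 1 => splitLast H (n + 1) ≫ (β_ (obj H (n + 1)) H).hom ≫
      (HopfObj.antipode (X := H) ⊗ₘ twistedReverse δ n)

theorem twistedAntipode_iterComul (δ : H ⟶ 𝟙_ C) (n : ℕ) :
    twistedAntipode H δ ≫ iterComul H n = iterComul H n ≫ twistedReverse δ n := by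
  induction n with
  | zero => exact rightUnitor_inv_naturality _
  | succ n ih =>
    change twistedAntipode H δ ≫ Δ[H] ≫ H ◁ iterComul H n = iterComul H (n + 1) ≫
      splitLast H (n + 1) ≫ (β_ (obj H (n + 1)) H).hom ≫
      (HopfObj.antipode (X := H) ⊗ₘ twistedReverse δ n)
    rw [← Category.assoc (iterComul H (n + 1)), iterComul_splitLast, Category.assoc,
      BraidedCategory.braiding_naturality_left_assoc, reassoc_of% twistedAntipode_comul H δ,
      MonoidalCategory.tensorHom_def', MonoidalCategory.tensorHom_def', ← whiskerLeft_comp_assoc,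
      ← ih]
    simp [← whisker_exchange]

end

section

variable {R M : Type*} [CommSemiring R] [AddCommMonoid M] [Module R M]

/-- The identification of `M ⊗ M^{⊗ n}` with `M^{⊗ (n + 1)}`, the new factor being the first. -/
noncomputable def tensorPowerConsEquiv (n : ℕ) : M ⊗[R] (⨂[R]^n M) ≃ₗ[R] ⨂[R]^(n + 1) M :=
  TensorProduct.congr (PiTensorProduct.subsingletonEquiv (s := fun _ => M) (0 : Fin 1)).symm
      (.refl R (⨂[R]^n M)) ≪≫ₗ
    TensorPower.mulEquiv ≪≫ₗ TensorPower.cast R M (add_comm 1 n)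

theorem tensorPowerConsEquiv_tmul_tprod {n : ℕ} (a : M) (x : Fin n → M) :
    tensorPowerConsEquiv n (a ⊗ₜ[R] PiTensorProduct.tprod R x) =
      PiTensorProduct.tprod R (Fin.cons a x : Fin (n + 1) → M) := by
  have h_append : tensorPowerConsEquiv n (a ⊗ₜ[R] PiTensorProduct.tprod R x) =
      PiTensorProduct.tprod R (Fin.append (fun _ : Fin 1 => a) x ∘ Fin.cast (add_comm n 1)) := by
    rw [← TensorPower.cast_tprod, ← TensorPower.tprod_mul_tprod,
      ← PiTensorProduct.subsingletonEquiv_symm_apply' (0 : Fin 1)]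
    rfl
  rw [h_append, Fin.append_left_eq_cons]
  rfl

end

open SuperSpace

variable {H : SuperSpace}

/-- The element `(a, h_1, …, h_n)` of `Cⁿ⁺¹(H)` for `a` in `H` and `(h_1, …, h_n)` in `Cⁿ(H)`. -/
def prepend (n : ℕ) : H →ₗ[ℂ] (obj H n : SuperSpace) →ₗ[ℂ] (obj H (n + 1) : SuperSpace) :=
  tmul H (obj H n)

theorem tensorElt_cons {n : ℕ} (a : H) (x : Fin n → H) :
    tensorElt H (n + 1) (Fin.cons a x : Fin (n + 1) → H) = prepend n a (tensorElt H n x) := rfl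

theorem tensorElt_succ {n : ℕ} (x : Fin (n + 1) → H) :
    tensorElt H (n + 1) x = prepend n (x 0) (tensorElt H n (Fin.tail x)) := rfl

theorem snocCochar_tensorElt (σ : 𝟙_ SuperSpace ⟶ H) {n : ℕ} (h : Fin n → H) :
    snocCochar H σ n (tensorElt H n h) =
      tensorElt H (n + 1) (Fin.snoc h (elt σ) : Fin (n + 1) → H) := by
  induction n with
  | zero => rfl
  | succ n ih =>
    cases h using Fin.consCases with | _ a x
    have h_prepend : snocCochar H σ (n + 1) (tensorElt H (n + 1) (Fin.cons a x)) =
        prepend (n + 1) a (snocCochar H σ n (tensorElt H n x)) := rfl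
    rw [h_prepend, ih, ← tensorElt_cons, Fin.cons_snoc_eq_snoc_cons]

theorem exists_equiv_tensorPower (H : SuperSpace) (n : ℕ) :
    ∃ e : (obj H n : SuperSpace) ≃ₗ[ℂ] ⨂[ℂ] _ : Fin n, H,
      ∀ h : Fin n → H, e (tensorElt H n h) = PiTensorProduct.tprod ℂ h := by
  induction n with
  | zero =>
    refine ⟨(PiTensorProduct.isEmptyEquiv (Fin 0)).symm, fun h => ?_⟩
    exact (LinearEquiv.symm_apply_eq _).2
      (PiTensorProduct.isEmptyEquiv_apply_tprod (R := ℂ) (Fin 0) h).symm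
  | succ n ih =>
    obtain ⟨e, he⟩ := ih
    refine ⟨TensorProduct.congr (.refl ℂ H) e ≪≫ₗ tensorPowerConsEquiv n, fun h => ?_⟩
    cases h using Fin.consCases with | _ a x
    rw [← tensorPowerConsEquiv_tmul_tprod, ← he]
    rfl

/-- The pure tensors with homogeneous entries in `Cⁿ(H)`. -/
def homogeneousTensors (H : SuperSpace) (n : ℕ) : Set (obj H n : SuperSpace) :=
  {t | ∃ (x : Fin n → H) (e : Fin n → ZMod 2),
    (∀ j, x j ∈ H.homogeneous (e j)) ∧ tensorElt H n x = t}

theorem span_homogeneousTensors (H : SuperSpace) (n : ℕ) :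
    Submodule.span ℂ (homogeneousTensors H n) = ⊤ := by
  induction n with
  | zero =>
    refine Submodule.eq_top_iff'.2 fun (t : ℂ) => ?_
    rw [← mul_one t]
    exact Submodule.smul_mem _ t (Submodule.subset_span ⟨Fin.elim0, Fin.elim0, nofun, rfl⟩)
  | succ n ih =>
    have h_top : Submodule.map₂ (prepend (H := H) n) ⊤ ⊤ = ⊤ :=
      TensorProduct.map₂_mk_top_top_eq_top ℂ H _
    rw [← SuperSpace.span_homogeneous, ← ih, Submodule.map₂_span_span] at h_top
    refine eq_top_iff.2 (h_top.ge.trans (Submodule.span_mono ?_))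
    rintro _ ⟨a, ⟨d, ha⟩, _, ⟨x, e, hx, rfl⟩, rfl⟩
    exact ⟨Fin.cons a x, Fin.cons d e, Fin.cases ha hx, rfl⟩

theorem exists_homogeneous_expansion {n : ℕ} (t : (obj H (n + 1) : SuperSpace)) :
    ∃ (r : ℕ) (x : Fin r → Fin (n + 1) → H) (e : Fin r → Fin (n + 1) → ZMod 2),
      (∀ k j, x k j ∈ H.homogeneous (e k j)) ∧ t = ∑ k, tensorElt H (n + 1) (x k) := by
  have ht : t ∈ Submodule.span ℂ (homogeneousTensors H (n + 1)) :=
    span_homogeneousTensors H (n + 1) ▸ Submodule.mem_top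
  obtain ⟨r, c, g, rfl⟩ := Submodule.mem_span_set'.1 ht
  choose x e hx hxg using fun k => (g k).2
  refine ⟨r, fun k => Fin.cons (c k • x k 0) (Fin.tail (x k)), e, fun k => ?_, ?_⟩
  · exact Fin.cases (Submodule.smul_mem _ _ (hx k 0)) fun j => hx k j.succ
  · simp only [tensorElt_cons, LinearMap.map_smul₂, ← tensorElt_succ, hxg]

section

variable [HopfObj H]

theorem face_zero_tensorElt (σ : 𝟙_ SuperSpace ⟶ H) {n : ℕ} (h : Fin n → H) :
    face H σ n 0 (tensorElt H n h) =
      tensorElt H (n + 1) (Fin.cons (oneElt H) h : Fin (n + 1) → H) := rfl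

theorem comulAt_zero_prepend {n r : ℕ} {a : H} {x y : Fin r → H}
    (ha : comulElt H a = ∑ k, x k ⊗ₜ[ℂ] y k) (t : (obj H n : SuperSpace)) :
    comulAt H (n + 1) 0 (prepend n a t) =
      ∑ k, prepend (n + 1) (x k) (prepend n (y k) t) := by
  have h_apply : comulAt H (n + 1) 0 (prepend n a t) =
    TensorProduct.assoc ℂ H H (obj H n : SuperSpace) (comulElt H a ⊗ₜ[ℂ] t) := rfl
  rw [h_apply, ha, TensorProduct.sum_tmul, map_sum]
  rfl

theorem comulAt_tensorElt {n r : ℕ} (h : Fin n → H) (i : Fin n) (x y : Fin r → H)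
    (hi : comulElt H (h i) = ∑ k, x k ⊗ₜ[ℂ] y k) :
    comulAt H n i (tensorElt H n h) = ∑ k, tensorElt H (n + 1)
      (i.castSucc.insertNth (x k) (Function.update h i (y k)) : Fin (n + 1) → H) := by
  induction n with
  | zero => exact i.elim0
  | succ n ih =>
    cases h using Fin.consCases with | _ a h
    induction i using Fin.cases with
    | zero =>
      rw [Fin.cons_zero] at hi
      rw [tensorElt_cons, comulAt_zero_prepend hi]
      simp only [Fin.castSucc_zero, Fin.insertNth_zero', Fin.update_cons_zero, tensorElt_cons]
    | succ i =>
      have h_prepend : comulAt H (n + 1) i.succ (tensorElt H (n + 1) (Fin.cons a h)) =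
        prepend (n + 1) a (comulAt H n i (tensorElt H n h)) := rfl
      rw [h_prepend, ih h i hi, map_sum]
      simp only [← Fin.cons_update, ← Fin.succ_castSucc, Fin.insertNth_succ_cons, tensorElt_cons]

theorem face_castSucc_succ_tensorElt (σ : 𝟙_ SuperSpace ⟶ H) {n r : ℕ} (h : Fin n → H)
    (i : Fin n) (x y : Fin r → H) (hi : comulElt H (h i) = ∑ k, x k ⊗ₜ[ℂ] y k) :
    face H σ n i.castSucc.succ (tensorElt H n h) = ∑ k, tensorElt H (n + 1)
      (i.castSucc.insertNth (x k) (Function.update h i (y k)) : Fin (n + 1) → H) := by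
  rw [face, Fin.cases_succ, Fin.lastCases_castSucc, comulAt_tensorElt h i x y hi]

theorem face_last_tensorElt (σ : 𝟙_ SuperSpace ⟶ H) {n : ℕ} (h : Fin n → H) :
    face H σ n (Fin.last (n + 1)) (tensorElt H n h) =
      tensorElt H (n + 1) (Fin.snoc h (elt σ) : Fin (n + 1) → H) := by
  rw [← Fin.succ_last, face, Fin.cases_succ, Fin.lastCases_last, snocCochar_tensorElt]

theorem degeneracy_tensorElt {n : ℕ} (h : Fin (n + 1) → H) (i : Fin (n + 1)) :
    degeneracy H n i (tensorElt H (n + 1) h) =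
      counitElt H (h i) • tensorElt H n (i.removeNth h) := by
  induction n with
  | zero => obtain rfl := Fin.fin_one_eq_zero i; rfl
  | succ n ih =>
    cases h using Fin.consCases with | _ a h
    induction i using Fin.cases with
    | zero => rfl
    | succ i =>
      have h_prepend : degeneracy H (n + 1) i.succ (tensorElt H (n + 2) (Fin.cons a h)) =
        prepend n a (degeneracy H n i (tensorElt H (n + 1) h)) := rfl
      rw [h_prepend, ih, map_smul, ← tensorElt_cons, Fin.cons_succ,
        ← Fin.cons_comp_succ_succAbove]
      rfl

end

theorem tensorElt_mem_homogeneous {n : ℕ} {x : Fin n → H} {e : Fin n → ZMod 2}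
    (hx : ∀ i, x i ∈ H.homogeneous (e i)) :
    tensorElt H n x ∈ (obj H n : SuperSpace).homogeneous (∑ i, e i) := by
  induction n with
  | zero => exact one_mem_homogeneous
  | succ n ih =>
    rw [Fin.sum_univ_succ]
    exact tmul_mem_homogeneous (hx 0) (ih fun i => hx i.succ)

theorem splitLast_tensorElt_snoc {n : ℕ} (x : Fin n → H) (a : H) :
    splitLast H n (tensorElt H (n + 1) (Fin.snoc x a : Fin (n + 1) → H)) =
      tmul (obj H n) H (tensorElt H n x) a := by
  induction n with
  | zero =>
    have h_unit : splitLast H 0 (prepend 0 a (tensorElt H 0 x)) =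
      tmul (𝟙_ SuperSpace) H (1 : ℂ) ((1 : ℂ) • a) := rfl
    rw [one_smul] at h_unit
    exact h_unit
  | succ n ih =>
    cases x using Fin.consCases with | _ b x
    rw [← Fin.cons_snoc_eq_snoc_cons]
    have h_prepend : splitLast H (n + 1) (prepend (n + 1) b
        (tensorElt H (n + 1) (Fin.snoc x a : Fin (n + 1) → H))) =
      (α_ H (obj H n) H).inv (tmul H (obj H n ⊗ H) b
        (splitLast H n (tensorElt H (n + 1) (Fin.snoc x a : Fin (n + 1) → H)))) := rfl
    rw [tensorElt_cons, h_prepend, ih]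
    rfl

theorem signAlpha_snoc {n : ℕ} (e : Fin (n + 1) → ZMod 2) (c : ZMod 2) :
    signAlpha (Fin.snoc e c : Fin (n + 2) → ZMod 2) =
      signAlpha e * (-1) ^ ((∑ i, e i) * c).val := by
  have h_sum (i : Fin (n + 1)) :
      ∑ j ∈ Finset.Iic i.castSucc, (Fin.snoc e c : Fin (n + 2) → ZMod 2) j =
        ∑ j ∈ Finset.Iic i, e j := by
    rw [← Fin.map_castSuccEmb_Iic, Finset.sum_map]
    simp only [Fin.coe_castSuccEmb, Fin.snoc_castSucc]
  have h_last : ∑ j ∈ Finset.Iic (Fin.last n), e j = ∑ i, e i := by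
    rw [← Fin.top_eq_last, Finset.Iic_top]
  simp only [signAlpha, h_sum, Fin.prod_univ_castSucc (n := n), h_last, Fin.succ_last,
    Fin.snoc_last, Fin.succ_castSucc, Fin.snoc_castSucc]

/-- The tensor product of the first `n` terms of a sequence in `H`. Sequences rather than families
over `Fin n` avoid transports between tensor powers of `H` with different presentations of the
exponent. -/
def streamElt (n : ℕ) (w : Stream' H) : (obj H n : SuperSpace) :=
  tensorElt H n fun i => w i

/-- The sequence `y 0, z 0, …, y (n - 1), z (n - 1), z n, z (n + 1), …`. -/
def interleaveTake {A : Type*} : ℕ → Stream' A → Stream' A → Stream' A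
  | 0, _, z => z
  | n + 1, y, z => .cons y.head (.cons z.head (interleaveTake n y.tail z.tail))

theorem streamElt_succ_cons (n : ℕ) (a : H) (w : Stream' H) :
    streamElt (n + 1) (.cons a w) = prepend n a (streamElt n w) := rfl

theorem concat_streamElt (m n : ℕ) (y z : Stream' H) :
    concat H m n (tmul (obj H m) (obj H n) (streamElt m y) (streamElt n z)) =
      streamElt (n + m) (y.take m ++ₛ z) := by
  induction m generalizing y with
  | zero => exact one_smul ℂ _
  | succ m ih =>
    have h_prepend : concat H (m + 1) n
        (tmul (obj H (m + 1)) (obj H n) (streamElt (m + 1) y) (streamElt n z)) =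
      prepend (n + m) y.head
        (concat H m n (tmul (obj H m) (obj H n) (streamElt m y.tail) (streamElt n z))) := rfl
    rw [h_prepend, ih]
    rfl

theorem braidLayer_prepend_prepend (n N : ℕ) {a b : H} {c d : ZMod 2} (ha : a ∈ H.homogeneous c)
    (hb : b ∈ H.homogeneous d) (t : (obj H N : SuperSpace)) :
    braidLayer H 0 (n + 1) (N + 2) (prepend (N + 1) a (prepend N b t)) =
      (-1 : ℂ) ^ (c * d).val • prepend (N + 1) b (prepend N a (braidLayer H 0 n N t)) := by
  have h_layer : braidLayer H 0 (n + 1) (N + 2) (prepend (N + 1) a (prepend N b t)) =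
    (α_ H H (obj H N)).hom
      (tmul (H ⊗ H) (obj H N) ((β_ H H).hom (tmul H H a b)) (braidLayer H 0 n N t)) := rfl
  rw [braiding_tmul ha hb, LinearMap.map_smul₂, map_smul] at h_layer
  exact h_layer

theorem braidLayer_streamElt {n N : ℕ} (hN : n + n ≤ N) {y z : Stream' H} {e d : ℕ → ZMod 2}
    (hy : ∀ i, y i ∈ H.homogeneous (e i)) (hz : ∀ i, z i ∈ H.homogeneous (d i)) :
    braidLayer H 0 n N (streamElt N (interleaveTake n y z)) =
      (∏ i ∈ Finset.range n, (-1 : ℂ) ^ (e i * d i).val) •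
        streamElt N (.cons z.head (interleaveTake n y z.tail)) := by
  induction n generalizing N y z e d with
  | zero =>
    rw [Finset.range_zero, Finset.prod_empty, one_smul]
    cases N <;> exact congrArg (streamElt _) (Stream'.eta z).symm
  | succ n ih =>
    obtain ⟨N, rfl⟩ : ∃ M, N = M + 2 := ⟨N - 2, by omega⟩
    have h_tail := ih (N := N) (by omega) (y := y.tail) (z := z.tail) (fun i => hy (i + 1))
      fun i => hz (i + 1)
    rw [interleaveTake, streamElt_succ_cons, streamElt_succ_cons,
      braidLayer_prepend_prepend n N (a := y.head) (b := z.head) (hy 0) (hz 0), h_tail, map_smul,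
      map_smul, smul_smul, Finset.prod_range_succ', mul_comm]
    rfl

theorem shuffleOn_streamElt {n N : ℕ} (hN : n + n ≤ N) {y z : Stream' H} {e d : ℕ → ZMod 2}
    (hy : ∀ i, y i ∈ H.homogeneous (e i)) (hz : ∀ i, z i ∈ H.homogeneous (d i)) :
    (shuffleOn H n N).toLin (streamElt N (y.take n ++ₛ z)) =
      (∏ j ∈ Finset.range n, (-1 : ℂ) ^ (e j * ∑ i ∈ Finset.range j, d i).val) •
        streamElt N (interleaveTake n y z) := by
  induction n generalizing N y e with
  | zero =>
    rw [Finset.range_zero, Finset.prod_empty, one_smul]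
    rfl
  | succ n ih =>
    obtain ⟨N, rfl⟩ : ∃ M, N = M + 1 := ⟨N - 1, by omega⟩
    have h_prepend : (shuffleOn H (n + 1) (N + 1)).toLin
        (streamElt (N + 1) (y.take (n + 1) ++ₛ z)) =
      prepend N y.head (braidLayer H 0 n N
        ((shuffleOn H n N).toLin (streamElt N (y.tail.take n ++ₛ z)))) := by
      rw [shuffleOn_succ_succ]
      rfl
    have h_sign : (∏ j ∈ Finset.range (n + 1), (-1 : ℂ) ^ (e j * ∑ i ∈ Finset.range j, d i).val) =
        (∏ j ∈ Finset.range n, (-1 : ℂ) ^ (e (j + 1) * ∑ i ∈ Finset.range j, d i).val) *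
          ∏ j ∈ Finset.range n, (-1 : ℂ) ^ (e (j + 1) * d j).val := by
      simp only [Finset.prod_range_succ', Finset.sum_range_succ, mul_add, neg_one_pow_val_add,
        Finset.prod_mul_distrib, Finset.sum_range_zero, mul_zero, ZMod.val_zero, pow_zero, mul_one]
    have hy' (i : ℕ) : y.tail i ∈ H.homogeneous (e (i + 1)) := hy (i + 1)
    rw [h_prepend, ih (by omega) hy', map_smul,
      braidLayer_streamElt (by omega) hy' hz, smul_smul, map_smul, h_sign]
    rfl

variable [HopfObj H]

theorem twistedReverse_tensorElt (δ : H ⟶ 𝟙_ SuperSpace) {n : ℕ} {x : Fin (n + 1) → H}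
    {e : Fin (n + 1) → ZMod 2} (hx : ∀ i, x i ∈ H.homogeneous (e i)) :
    twistedReverse δ n (tensorElt H (n + 1) x) = signAlpha e • tensorElt H (n + 1)
      (Fin.snoc (fun i : Fin n => HopfObj.antipode (X := H) (x i.castSucc.rev))
        (twistedAntipode H δ (x 0)) : Fin (n + 1) → H) := by
  induction n with
  | zero =>
    rw [signAlpha, Finset.univ_eq_empty, Finset.prod_empty, one_smul]
    rfl
  | succ n ih =>
    cases x using Fin.snocCases with | _ x a
    cases e using Fin.snocCases with | _ e c
    have hxe (i : Fin (n + 1)) : x i ∈ H.homogeneous (e i) := by simpa using hx i.castSucc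
    have hac : a ∈ H.homogeneous c := by simpa using hx (Fin.last _)
    have h_comp : twistedReverse δ (n + 1)
        (tensorElt H (n + 2) (Fin.snoc x a : Fin (n + 2) → H)) =
      (HopfObj.antipode (X := H) ⊗ₘ twistedReverse δ n) ((β_ (obj H (n + 1)) H).hom
        (splitLast H (n + 1) (tensorElt H (n + 2) (Fin.snoc x a : Fin (n + 2) → H)))) := rfl
    rw [h_comp, splitLast_tensorElt_snoc, braiding_tmul (tensorElt_mem_homogeneous hxe) hac,
      map_smul, tensorHom_tmul, ih hxe, map_smul, smul_smul, signAlpha_snoc, mul_comm]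
    have h_rev : (fun i : Fin (n + 1) => HopfObj.antipode (X := H)
          ((Fin.snoc x a : Fin (n + 2) → H) i.castSucc.rev)) =
        Fin.cons (HopfObj.antipode (X := H) a)
          fun i : Fin n => HopfObj.antipode (X := H) (x i.castSucc.rev) := by
      refine funext (Fin.cases ?_ fun i => ?_)
      · simp
      · rw [← Fin.succ_castSucc, Fin.rev_succ, Fin.snoc_castSucc, Fin.cons_succ]
    have h_zero : (Fin.snoc x a : Fin (n + 2) → H) 0 = x 0 := Fin.snoc_castSucc (i := 0) ..
    rw [h_rev, h_zero, ← Fin.cons_snoc_eq_snoc_cons, tensorElt_cons]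
    rfl

theorem mulPairs_streamElt {n N : ℕ} (hN : N = n + n) (y z : Stream' H) :
    mulPairs H n N hN (streamElt N (interleaveTake n y z)) =
      streamElt n (Stream'.zip (mulElt H) y z) := by
  induction n generalizing N y z with
  | zero =>
    subst hN
    rfl
  | succ n ih =>
    obtain ⟨N, rfl⟩ : ∃ M, N = M + 2 := ⟨N - 2, by omega⟩
    have h_prepend : mulPairs H (n + 1) (N + 2) hN
        (streamElt (N + 2) (interleaveTake (n + 1) y z)) =
      prepend n (mulElt H y.head z.head) (mulPairs H n N (by omega)
        (streamElt N (interleaveTake n y.tail z.tail))) := rfl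
    rw [h_prepend, ih, Stream'.zip_eq (mulElt H) y z]
    rfl

theorem mulPow_streamElt (n : ℕ) {y z : Stream' H} {e d : ℕ → ZMod 2}
    (hy : ∀ i, y i ∈ H.homogeneous (e i)) (hz : ∀ i, z i ∈ H.homogeneous (d i)) :
    mulPow H n (tmul (obj H n) (obj H n) (streamElt n y) (streamElt n z)) =
      (∏ j ∈ Finset.range n, (-1 : ℂ) ^ (e j * ∑ i ∈ Finset.range j, d i).val) •
        streamElt n (Stream'.zip (mulElt H) y z) := by
  have h_comp : mulPow H n (tmul (obj H n) (obj H n) (streamElt n y) (streamElt n z)) =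
    mulPairs H n (n + n) rfl ((shuffleOn H n (n + n)).toLin
      (concat H n n (tmul (obj H n) (obj H n) (streamElt n y) (streamElt n z)))) := rfl
  rw [h_comp, concat_streamElt, shuffleOn_streamElt le_rfl hy hz, map_smul, mulPairs_streamElt]

theorem mulPow_tensorElt {n : ℕ} {y z : Fin n → H} {e d : Fin n → ZMod 2}
    (hy : ∀ i, y i ∈ H.homogeneous (e i)) (hz : ∀ i, z i ∈ H.homogeneous (d i)) :
    mulPow H n (tmul (obj H n) (obj H n) (tensorElt H n y) (tensorElt H n z)) =
      (∏ j, (-1 : ℂ) ^ (e j * ∑ i ∈ Finset.Iio j, d i).val) •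
        tensorElt H n fun i => mulElt H (y i) (z i) := by
  let extend {A : Type} [Zero A] (x : Fin n → A) : ℕ → A := Function.extend Fin.val x 0
  have h_extend {A : Type} [Zero A] (x : Fin n → A) (i : Fin n) : extend x i = x i :=
    Fin.val_injective.extend_apply x 0 i
  have h_hom {x : Fin n → H} {c : Fin n → ZMod 2} (hx : ∀ i, x i ∈ H.homogeneous (c i)) (i : ℕ) :
      extend x i ∈ H.homogeneous (extend c i) := by
    by_cases hi : i < n
    · lift i to Fin n using hi
      rw [h_extend, h_extend]
      exact hx i
    · have h_zero : extend x i = 0 :=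
        Function.extend_apply' x (0 : ℕ → H) i fun ⟨j, hj⟩ => hi (hj ▸ j.isLt)
      exact h_zero ▸ zero_mem _
  have h_stream (x : Fin n → H) : streamElt n (extend x) = tensorElt H n x :=
    congrArg (tensorElt H n) (funext (h_extend x))
  have h_sum (j : Fin n) :
      ∑ i ∈ Finset.range j, extend d i = ∑ i ∈ Finset.Iio j, d i := by
    rw [← Nat.Iio_eq_range, ← Fin.map_valEmbedding_Iio, Finset.sum_map]
    exact Finset.sum_congr rfl fun i _ => h_extend d i
  have h_zip : streamElt n (Stream'.zip (mulElt H) (extend y) (extend z)) =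
      tensorElt H n fun i => mulElt H (y i) (z i) :=
    congrArg (tensorElt H n) <| funext fun i => congrArg₂ (mulElt H) (h_extend y i) (h_extend z i)
  rw [← h_stream y, ← h_stream z, mulPow_streamElt n (h_hom hy) (h_hom hz), h_zip,
    Finset.prod_range]
  simp only [h_sum, h_extend]

theorem signBeta_eq_prod_Iio {n : ℕ} (e d : Fin (n + 1) → ZMod 2) :
    signBeta e d = ∏ j, (-1 : ℂ) ^ (e (Fin.rev j) *
      ∑ i ∈ Finset.Iio j, (Fin.snoc (Fin.tail d) 0 : Fin (n + 1) → ZMod 2) i).val := by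
  have h_sum (k : Fin n) :
      ∑ i ∈ Finset.Iio k.succ, (Fin.snoc (Fin.tail d) 0 : Fin (n + 1) → ZMod 2) i =
        ∑ l ∈ Finset.Ioc 0 k.succ, d l := by
    have h_Iio : Finset.Iio k.succ = Finset.Iic k.castSucc := rfl
    rw [h_Iio, ← Fin.map_castSuccEmb_Iic, ← Fin.map_succEmb_Iic, Finset.sum_map, Finset.sum_map]
    exact Finset.sum_congr rfl fun i _ => Fin.snoc_castSucc (i := i) ..
  have h_zero : Finset.Iio (0 : Fin (n + 1)) = ∅ := rfl
  rw [Fin.prod_univ_succ, h_zero, Finset.sum_empty, mul_zero, ZMod.val_zero, pow_zero, one_mul,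
    signBeta, ← Equiv.prod_comp Fin.revPerm]
  simp only [h_sum, Fin.revPerm_apply, Fin.rev_succ, Fin.rev_castSucc, Fin.rev_rev]

theorem cyclic_tensorElt (δ : H ⟶ 𝟙_ SuperSpace) (σ : 𝟙_ SuperSpace ⟶ H) {n : ℕ}
    (h : Fin (n + 1) → H) (d : Fin (n + 1) → ZMod 2) (hd : ∀ l, h l ∈ H.homogeneous (d l))
    {r : ℕ} (x : Fin r → Fin (n + 1) → H) (e : Fin r → Fin (n + 1) → ZMod 2)
    (he : ∀ k j, x k j ∈ H.homogeneous (e k j))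
    (hx : iterComul H n (h 0) = ∑ k, tensorElt H (n + 1) (x k)) :
    cyclic H δ σ (n + 1) (tensorElt H (n + 1) h) =
      ∑ k, (signAlpha (e k) * signBeta (e k) d) • tensorElt H (n + 1)
        (Fin.snoc
          (fun i : Fin n => mulElt H (HopfObj.antipode (X := H) (x k i.castSucc.rev)) (h i.succ))
          (mulElt H (twistedAntipode H δ (x k 0)) (elt σ)) : Fin (n + 1) → H) := by
  have h_comp : cyclic H δ σ (n + 1) (tensorElt H (n + 1) h) =
    mulPow H (n + 1) (tmul (obj H (n + 1)) (obj H (n + 1))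
      ((twistedAntipode H δ ≫ iterComul H n) (h 0))
      (snocCochar H σ n (tensorElt H n (Fin.tail h)))) := rfl
  have h_left : (twistedAntipode H δ ≫ iterComul H n) (h 0) =
      ∑ k, twistedReverse δ n (tensorElt H (n + 1) (x k)) := by
    rw [twistedAntipode_iterComul, comp_toLin, LinearMap.comp_apply, hx, map_sum]
  have h_right (i : Fin (n + 1)) : (Fin.snoc (Fin.tail h) (elt σ) : Fin (n + 1) → H) i ∈
      H.homogeneous ((Fin.snoc (Fin.tail d) 0 : Fin (n + 1) → ZMod 2) i) := by
    cases i using Fin.lastCases with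
    | last => simpa [elt] using apply_mem_homogeneous σ one_mem_homogeneous
    | cast i => simpa [Fin.tail] using hd i.succ
  rw [h_comp, h_left, snocCochar_tensorElt, LinearMap.map_sum₂, map_sum]
  refine Finset.sum_congr rfl fun k _ => ?_
  rw [twistedReverse_tensorElt δ (he k), LinearMap.map_smul₂, map_smul]
  have h_rev (i : Fin (n + 1)) : (Fin.snoc
        (fun i : Fin n => HopfObj.antipode (X := H) (x k i.castSucc.rev))
        (twistedAntipode H δ (x k 0)) : Fin (n + 1) → H) i ∈ H.homogeneous (e k i.rev) := by
    cases i using Fin.lastCases with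
    | last => simpa using apply_mem_homogeneous (twistedAntipode H δ) (he k 0)
    | cast i => simpa using apply_mem_homogeneous HopfObj.antipode (he k i.castSucc.rev)
  rw [mulPow_tensorElt h_rev h_right, smul_smul, ← signBeta_eq_prod_Iio]
  congr 2
  refine funext (Fin.lastCases ?_ fun i => ?_)
  · simp only [Fin.snoc_last]
  · simp only [Fin.snoc_castSucc, Fin.tail]

end ConnesMoscovici

open ConnesMoscovici in
theorem mainTheorem10_general (H : SuperSpace) [HopfObj H]
    (δ : H ⟶ 𝟙_ SuperSpace) (σ : 𝟙_ SuperSpace ⟶ H) :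
    obj H 0 = 𝟙_ SuperSpace ∧
    (∀ n : ℕ, ∃ e : (obj (C := SuperSpace) H n).carrier ≃ₗ[ℂ] (⨂[ℂ] _ : Fin n, H),
      ∀ h : Fin n → H, e (tensorElt H n h) = PiTensorProduct.tprod ℂ h) ∧
    (∀ (n : ℕ) (h : Fin n → H),
      face H σ n 0 (tensorElt H n h) =
        tensorElt H (n + 1) (Fin.cons (oneElt H) h : Fin (n + 1) → H)) ∧
    (∀ (n : ℕ) (h : Fin n → H) (i : Fin n) (r : ℕ) (x y : Fin r → H),
      comulElt H (h i) = ∑ k, x k ⊗ₜ[ℂ] y k →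
      face H σ n i.castSucc.succ (tensorElt H n h) =
        ∑ k, tensorElt H (n + 1)
          (i.castSucc.insertNth (x k) (Function.update h i (y k)) : Fin (n + 1) → H)) ∧
    (∀ (n : ℕ) (h : Fin n → H),
      face H σ n (Fin.last (n + 1)) (tensorElt H n h) =
        tensorElt H (n + 1) (Fin.snoc h (elt σ) : Fin (n + 1) → H)) ∧
    (∀ (n : ℕ) (h : Fin (n + 1) → H) (i : Fin (n + 1)),
      degeneracy H n i (tensorElt H (n + 1) h) =
        counitElt H (h i) • tensorElt H n (i.removeNth h)) ∧
    cyclic H δ σ 0 = 𝟙 (obj H 0) ∧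
    (∀ (n : ℕ) (a : H), ∃ (r : ℕ) (x : Fin r → Fin (n + 1) → H) (e : Fin r → Fin (n + 1) → ZMod 2),
      (∀ k j, x k j ∈ H.homogeneous (e k j)) ∧
      iterComul H n a = ∑ k, tensorElt H (n + 1) (x k)) ∧
    (∀ (n : ℕ) (h : Fin (n + 1) → H) (d : Fin (n + 1) → ZMod 2),
      (∀ l, h l ∈ H.homogeneous (d l)) →
      ∀ (r : ℕ) (x : Fin r → Fin (n + 1) → H) (e : Fin r → Fin (n + 1) → ZMod 2),
      (∀ k j, x k j ∈ H.homogeneous (e k j)) →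
      iterComul H n (h 0) = ∑ k, tensorElt H (n + 1) (x k) →
      cyclic H δ σ (n + 1) (tensorElt H (n + 1) h) =
        ∑ k, (signAlpha (e k) * signBeta (e k) d) •
          tensorElt H (n + 1)
            (Fin.snoc
              (fun i : Fin n =>
                mulElt H (HopfObj.antipode (X := H) (x k i.castSucc.rev)) (h i.succ))
              (mulElt H (twistedAntipode H δ (x k 0)) (elt σ)) : Fin (n + 1) → H)) :=
  ⟨rfl, exists_equiv_tensorPower H, fun _ => face_zero_tensorElt σ,
    fun _ h i _ => face_castSucc_succ_tensorElt σ h i, fun _ => face_last_tensorElt σ,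
    fun _ => degeneracy_tensorElt, rfl, fun n a => exists_homogeneous_expansion (iterComul H n a),
    fun _ h d hd _ => cyclic_tensorElt δ σ h d hd⟩

theorem mainTheorem10 (H : SuperSpace) [HopfObj H]
    (δ : H ⟶ 𝟙_ SuperSpace) (σ : 𝟙_ SuperSpace ⟶ H)
    (hMPI : ConnesMoscovici.IsBraidedMPI H δ σ) :
    -- the complex: `C⁰(H) = ℂ`, and `Cⁿ(H)` is the `n`-th tensor power of `H`
    ConnesMoscovici.obj H 0 = 𝟙_ SuperSpace ∧
    (∀ n : ℕ, ∃ e : (ConnesMoscovici.obj (C := SuperSpace) H n).carrier ≃ₗ[ℂ] (⨂[ℂ] _ : Fin n, H),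
      ∀ h : Fin n → H, e (ConnesMoscovici.tensorElt H n h) = PiTensorProduct.tprod ℂ h) ∧
    -- the faces `δ_0`, `δ_i` for `1 ≤ i ≤ n`, and `δ_{n+1}` from `Cⁿ(H)` to `Cⁿ⁺¹(H)`
    (∀ (n : ℕ) (h : Fin n → H),
      ConnesMoscovici.face H σ n 0 (ConnesMoscovici.tensorElt H n h) =
        ConnesMoscovici.tensorElt H (n + 1) (Fin.cons (ConnesMoscovici.oneElt H) h : Fin (n + 1) → H)) ∧
    (∀ (n : ℕ) (h : Fin n → H) (i : Fin n) (r : ℕ) (x y : Fin r → H),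
      ConnesMoscovici.comulElt H (h i) = ∑ k, x k ⊗ₜ[ℂ] y k →
      ConnesMoscovici.face H σ n i.castSucc.succ (ConnesMoscovici.tensorElt H n h) =
        ∑ k, ConnesMoscovici.tensorElt H (n + 1)
          (i.castSucc.insertNth (x k) (Function.update h i (y k)) : Fin (n + 1) → H)) ∧
    (∀ (n : ℕ) (h : Fin n → H),
      ConnesMoscovici.face H σ n (Fin.last (n + 1)) (ConnesMoscovici.tensorElt H n h) =
        ConnesMoscovici.tensorElt H (n + 1)
          (Fin.snoc h (ConnesMoscovici.elt σ) : Fin (n + 1) → H)) ∧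
    -- the degeneracies `σ_i` for `0 ≤ i ≤ n` from `Cⁿ⁺¹(H)` to `Cⁿ(H)`
    (∀ (n : ℕ) (h : Fin (n + 1) → H) (i : Fin (n + 1)),
      ConnesMoscovici.degeneracy H n i (ConnesMoscovici.tensorElt H (n + 1) h) =
        ConnesMoscovici.counitElt H (h i) • ConnesMoscovici.tensorElt H n (i.removeNth h)) ∧
    -- the cyclic map in degree `0`
    ConnesMoscovici.cyclic H δ σ 0 = 𝟙 (ConnesMoscovici.obj H 0) ∧
    -- every element has a Sweedler expansion `Δⁿ a = ∑ a⁽¹⁾ ⊗ ⋯ ⊗ a⁽ⁿ⁺¹⁾` with homogeneous entries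
    (∀ (n : ℕ) (a : H), ∃ (r : ℕ) (x : Fin r → Fin (n + 1) → H) (e : Fin r → Fin (n + 1) → ZMod 2),
      (∀ k j, x k j ∈ H.homogeneous (e k j)) ∧
      ConnesMoscovici.iterComul H n a = ∑ k, ConnesMoscovici.tensorElt H (n + 1) (x k)) ∧
    -- the cyclic map in degree `n + 1`, on homogeneous `h_1, …, h_{n+1}`, for every such expansion
    (∀ (n : ℕ) (h : Fin (n + 1) → H) (d : Fin (n + 1) → ZMod 2),
      (∀ l, h l ∈ H.homogeneous (d l)) →
      ∀ (r : ℕ) (x : Fin r → Fin (n + 1) → H) (e : Fin r → Fin (n + 1) → ZMod 2),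
      (∀ k j, x k j ∈ H.homogeneous (e k j)) →
      ConnesMoscovici.iterComul H n (h 0) = ∑ k, ConnesMoscovici.tensorElt H (n + 1) (x k) →
      ConnesMoscovici.cyclic H δ σ (n + 1) (ConnesMoscovici.tensorElt H (n + 1) h) =
        ∑ k, (ConnesMoscovici.signAlpha (e k) * ConnesMoscovici.signBeta (e k) d) •
          ConnesMoscovici.tensorElt H (n + 1)
            (Fin.snoc
              (fun i : Fin n =>
                ConnesMoscovici.mulElt H (HopfObj.antipode (X := H) (x k i.castSucc.rev))
                  (h i.succ))
              (ConnesMoscovici.mulElt H (ConnesMoscovici.twistedAntipode H δ (x k 0))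
                (ConnesMoscovici.elt σ)) : Fin (n + 1) → H)) :=
  mainTheorem10_general H δ σ
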